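/- Let $D$ be a division ring with center $F$. Call $D$ \emph{centrally finite} if $\dim_F D<\infty$; \emph{locally finite} if for every finite $S\subseteq D$ the division subring $F(S)$ generated by $S\cup F$ is finite dimensional over $F$; \emph{weakly locally finite} if for every finite $S\subseteq D$ the division subring of $D$ generated by $S$ is centrally finite; \emph{algebraic} if every element of $D$ is algebraic over $F$. \textbf{Proposition.} Every locally finite division ring is weakly locally finite. There exists a weakly locally finite division ring which is not algebraic over its center, and hence not locally finite; so the class of weakly locally finite division rings strictly contains the class of locally finite ones. Explicitly, let $p_1<p_2<\cdots$ be any increasing sequence of prime numbers and $K=\mathbb{Q}(\sqrt{p_1},\sqrt{p_2},\ldots)\subset\mathbb{R}$. There are automorphisms $f_i\in\mathrm{Gal}(K/\mathbb{Q})$ $(i\ge 1)$ with $f_i(\sqrt{p_i})=-\sqrt{p_i}$ and $f_i(\sqrt{p_j})=\sqrt{p_j}$ for $j\ne i$. Let $G=\bigoplus_{i\ge1}\mathbb{Z}$, written multiplicatively, be the free abelian group on $x_1,x_2,\ldots$, ordered lexicographically ($x<y$ iff the exponent of $x$ is smaller than that of $y$ at the first index where they differ). The automorphisms $f_i$ commute;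 let $\Phi:G\to \mathrm{Gal}(K/\mathbb{Q})$, $x\mapsto\Phi_x$, be the homomorphism with $\Phi_{x_i}=f_i$. Let $K((G,\Phi))$ be the division ring of formal sums $\sum_{x\in G}a_x x$ $(a_x\in K)$ with well-ordered support, with termwise addition and the multiplication $$\Big(\sum_x a_x x\Big)\Big(\sum_y b_y y\Big)=\sum_{z}\Big(\sum_{xy=z}a_x\Phi_x(b_y)\Big)z .$$ Let $F$ be the center of $K((G,\Phi))$, let $\gamma=x_1^{-1}+x_2^{-1}+\cdots\in K((G,\Phi))$, let $R_n=F(\sqrt{p_1},\ldots,\sqrt{p_n},x_1,\ldots,x_n,\gamma)$ be the division subring generated by $F$ and the listed elements, and let $R_\infty=\bigcup_{n}R_n$. Then $R_\infty$ is a division ring which is weakly locally finite, is not algebraic over its center, and is not locally finite. -/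

import Mathlib

noncomputable section

/-! ### Finiteness conditions on division rings -/

/-- A division ring is centrally finite if it is finite dimensional over its center. -/
def IsCentrallyFinite (D : Type*) [DivisionRing D] : Prop :=
  Module.Finite (Subring.center D) D

/-- `F(S)`: the division subring generated by `S` and the center `F` of `D`,
regarded as an `F`-subalgebra of `D`. (Mathlib's `Subfield` of a division ring is a division
subring, not necessarily commutative.) -/
def centerAdjoin {D : Type*} [DivisionRing D] (S : Set D) : Subalgebra (Subring.center D) D where
  __ := (Subfield.closure ((Subring.center D : Set D) ∪ S)).toSubring
  algebraMap_mem' r := Subfield.subset_closure (Or.inl r.2)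

/-- A division ring `D` with center `F` is locally finite if `F(S)` is finite dimensional over `F`
for every finite subset `S`. -/
def IsLocallyFiniteDivisionRing (D : Type*) [DivisionRing D] : Prop :=
  ∀ S : Set D, S.Finite → Module.Finite (Subring.center D) (centerAdjoin S)

/-- A division ring is weakly locally finite if the division subring generated by any finite subset
is centrally finite. -/
def IsWeaklyLocallyFiniteDivisionRing (D : Type*) [DivisionRing D] : Prop :=
  ∀ S : Set D, S.Finite → IsCentrallyFinite (Subfield.closure S)

/-! ### Twisted Mal'cev–Neumann series `K((G, Φ))`

The ordered abelian group `G` is written additively. -/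

/-- Formal sums `∑ a_x x` with `a_x ∈ K`, `x ∈ G`, whose support is well-ordered. -/
@[ext]
structure MalcevNeumann {k K G : Type*} [Field k] [Field K] [Algebra k K]
    [AddCommGroup G] [LinearOrder G] (Φ : Multiplicative G →* (K ≃ₐ[k] K)) where
  coeff : G → K
  isWF_support : (Function.support coeff).IsWF

namespace MalcevNeumann

section Basic

variable {k K G : Type*} [Field k] [Field K] [Algebra k K] [AddCommGroup G] [LinearOrder G]
  {Φ : Multiplicative G →* (K ≃ₐ[k] K)}

theorem isPWO_support (a : MalcevNeumann Φ) : (Function.support a.coeff).IsPWO :=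
  Set.isPWO_iff_isWF.2 a.isWF_support

/-- The one-term series `c · x`. -/
def single (x : G) (c : K) : MalcevNeumann Φ where
  coeff := Pi.single x c
  isWF_support := (Set.finite_singleton x).isWF.mono Pi.support_single_subset

instance : Zero (MalcevNeumann Φ) where
  zero := ⟨0, by simp⟩

/-- The unit `1 = 1 · x⁰`. -/
instance : One (MalcevNeumann Φ) where
  one := single 0 1

instance : Add (MalcevNeumann Φ) where
  add a b := ⟨fun x => a.coeff x + b.coeff x,
    (Set.isPWO_iff_isWF.1 (a.isPWO_support.union b.isPWO_support)).mono
      (Function.support_add _ _)⟩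

instance : Neg (MalcevNeumann Φ) where
  neg a := ⟨fun x => - a.coeff x, a.isWF_support.mono (by intro x; simp)⟩

theorem coeff_zero (z : G) : (0 : MalcevNeumann Φ).coeff z = 0 := rfl

theorem coeff_add (a b : MalcevNeumann Φ) (z : G) :
    (a + b).coeff z = a.coeff z + b.coeff z := rfl

theorem coeff_neg (a : MalcevNeumann Φ) (z : G) : (-a).coeff z = -a.coeff z := rfl

theorem coeff_one (z : G) : (1 : MalcevNeumann Φ).coeff z = if z = 0 then 1 else 0 := by
  change Pi.single (M := fun _ : G => K) 0 1 z = _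
  rw [Pi.single_apply]

theorem coeff_single (x z : G) (c : K) :
    (single x c : MalcevNeumann Φ).coeff z = if z = x then c else 0 := by
  change Pi.single (M := fun _ : G => K) x c z = _
  rw [Pi.single_apply]

end Basic

section Construction

open scoped Pointwise

set_option linter.unusedSectionVars false

variable {k K G : Type*} [Field k] [Field K] [Algebra k K]
  [AddCommGroup G] [LinearOrder G] [IsOrderedAddMonoid G]
  {Φ : Multiplicative G →* (K ≃ₐ[k] K)}

theorem support_mul_aux (a b : MalcevNeumann Φ) :
    (Function.support fun z => ∑ xy ∈ Finset.antidiagonal a.isPWO_support b.isPWO_support z,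
      a.coeff xy.1 * Φ (Multiplicative.ofAdd xy.1) (b.coeff xy.2)) ⊆
      Function.support a.coeff + Function.support b.coeff := by
  intro z hz
  obtain ⟨xy, hxy, -⟩ := Finset.exists_ne_zero_of_sum_ne_zero hz
  rw [Finset.mem_antidiagonal] at hxy
  exact ⟨xy.1, hxy.1, xy.2, hxy.2.1, hxy.2.2⟩

/-- `αβ = ∑_z (∑_{xy = z} a_x Φ_x(b_y)) z`; the inner sum runs over the finitely many pairs
`(x, y) ∈ supp α × supp β` with product `z`. -/
instance : Mul (MalcevNeumann Φ) where
  mul a b := ⟨fun z => ∑ xy ∈ Finset.antidiagonal a.isPWO_support b.isPWO_support z,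
      a.coeff xy.1 * Φ (Multiplicative.ofAdd xy.1) (b.coeff xy.2),
    (Set.isPWO_iff_isWF.1 (a.isPWO_support.add b.isPWO_support)).mono (support_mul_aux a b)⟩

theorem coeff_mul (a b : MalcevNeumann Φ) (z : G) : (a * b).coeff z =
    ∑ xy ∈ Finset.antidiagonal a.isPWO_support b.isPWO_support z,
      a.coeff xy.1 * Φ (Multiplicative.ofAdd xy.1) (b.coeff xy.2) := rfl

/-! The ring axioms are verified by letting `a_x x` act on `K` as `a_x Φ_x`, which embeds
`K((G, Φ))` in the Hahn series over the endomorphism ring of `(K, +)`. -/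

variable (Φ) in
/-- The operator `v ↦ c Φ_x(v)`, additive in `c`. -/
def twist (x : G) : K →+ AddMonoid.End K where
  toFun c := (AddMonoidHom.mulLeft c).comp (Φ (Multiplicative.ofAdd x) : K →+ K)
  map_zero' := by ext v; exact zero_mul _
  map_add' a b := by ext v; exact add_mul _ _ _

theorem twist_apply (x : G) (c v : K) :
    twist Φ x c v = c * Φ (Multiplicative.ofAdd x) v := rfl

theorem twist_inj (x : G) : Function.Injective (twist Φ x) := by
  intro c d h
  have := DFunLike.congr_fun h (1 : K)
  simpa [twist_apply] using this

theorem twist_mul (x y : G) (c d : K) :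
    twist Φ x c * twist Φ y d = twist Φ (x + y) (c * Φ (Multiplicative.ofAdd x) d) := by
  ext v
  change twist Φ x c (twist Φ y d v) = _
  simp [twist_apply, ofAdd_add, mul_assoc]

/-- The embedding in Hahn series. -/
def toHahn (a : MalcevNeumann Φ) : HahnSeries G (AddMonoid.End K) where
  coeff x := twist Φ x (a.coeff x)
  isPWO_support' := a.isPWO_support.mono (by
    intro x hx hax
    exact hx (by simp only [hax, map_zero]))

theorem toHahn_coeff (a : MalcevNeumann Φ) (x : G) :
    (toHahn a).coeff x = twist Φ x (a.coeff x) := rfl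

theorem toHahn_support (a : MalcevNeumann Φ) : (toHahn a).support = Function.support a.coeff := by
  ext x
  simp [toHahn_coeff, map_eq_zero_iff _ (twist_inj (Φ := Φ) x)]

theorem toHahn_inj : Function.Injective (toHahn (Φ := Φ)) := by
  intro a b h
  ext x
  exact twist_inj x (by rw [← toHahn_coeff, h, toHahn_coeff])

theorem toHahn_zero : toHahn (0 : MalcevNeumann Φ) = 0 := by
  apply HahnSeries.ext
  funext x
  simp [toHahn_coeff, coeff_zero]

theorem toHahn_one : toHahn (1 : MalcevNeumann Φ) = 1 := by
  apply HahnSeries.ext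
  funext x
  rw [toHahn_coeff, coeff_one, HahnSeries.coeff_one]
  split_ifs with h
  · subst h
    ext v
    simp [twist_apply]
  · simp

theorem toHahn_add (a b : MalcevNeumann Φ) : toHahn (a + b) = toHahn a + toHahn b := by
  apply HahnSeries.ext
  funext x
  simp [toHahn_coeff, coeff_add]

theorem toHahn_neg (a : MalcevNeumann Φ) : toHahn (-a) = -toHahn a := by
  apply HahnSeries.ext
  funext x
  simp [toHahn_coeff, coeff_neg]

theorem toHahn_mul (a b : MalcevNeumann Φ) : toHahn (a * b) = toHahn a * toHahn b := by
  apply HahnSeries.ext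
  funext z
  rw [toHahn_coeff, coeff_mul, map_sum,
    HahnSeries.coeff_mul_left' a.isPWO_support (toHahn_support a).le]
  have h : Finset.antidiagonal a.isPWO_support (toHahn b).isPWO_support z =
      Finset.antidiagonal a.isPWO_support b.isPWO_support z := by
    ext xy
    simp only [Finset.mem_antidiagonal, toHahn_support]
  rw [h]
  refine Finset.sum_congr rfl fun xy hxy => ?_
  rw [toHahn_coeff, toHahn_coeff, twist_mul, (Finset.mem_antidiagonal.1 hxy).2.2]

instance instRing : Ring (MalcevNeumann Φ) where
  add_assoc a b c := toHahn_inj (by simp only [toHahn_add, add_assoc])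
  zero_add a := toHahn_inj (by simp only [toHahn_add, toHahn_zero, zero_add])
  add_zero a := toHahn_inj (by simp only [toHahn_add, toHahn_zero, add_zero])
  add_comm a b := toHahn_inj (by simp only [toHahn_add, add_comm])
  neg_add_cancel a := toHahn_inj (by
    rw [toHahn_add, toHahn_neg, toHahn_zero]; exact neg_add_cancel (toHahn a))
  mul_assoc a b c := toHahn_inj (by simp only [toHahn_mul, mul_assoc])
  one_mul a := toHahn_inj (by simp only [toHahn_mul, toHahn_one, one_mul])
  mul_one a := toHahn_inj (by simp only [toHahn_mul, toHahn_one, mul_one])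
  left_distrib a b c := toHahn_inj (by simp only [toHahn_mul, toHahn_add, mul_add])
  right_distrib a b c := toHahn_inj (by simp only [toHahn_mul, toHahn_add, add_mul])
  zero_mul a := toHahn_inj (by simp only [toHahn_mul, toHahn_zero, zero_mul])
  mul_zero a := toHahn_inj (by simp only [toHahn_mul, toHahn_zero, mul_zero])
  nsmul := nsmulRec
  zsmul := zsmulRec

instance : Nontrivial (MalcevNeumann Φ) :=
  ⟨0, 1, fun h => by
    have := congrArg (fun a : MalcevNeumann Φ => a.coeff 0) h
    simp [coeff_zero, coeff_one] at this⟩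

/-! Existence of inverses: a nonzero series is a unit monomial times `1 - e` with `e` supported on
positive elements, and `1 - e` is inverted by the geometric series. -/

theorem toHahn_pow (a : MalcevNeumann Φ) (n : ℕ) : toHahn (a ^ n) = toHahn a ^ n := by
  induction n with
  | zero => simp [toHahn_one]
  | succ n ih => rw [pow_succ, pow_succ, toHahn_mul, ih]

theorem hahn_pow_finite {R : Type*} [Ring R] {x : HahnSeries G R}
    (hx : ∀ g ∈ x.support, 0 < g) :
    (⋃ n : ℕ, (x ^ n).support).IsPWO ∧ ∀ g, {n : ℕ | (x ^ n).coeff g ≠ 0}.Finite := by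
  have hpwo : (⋃ n : ℕ, (x ^ n).support).IsPWO :=
    (x.isPWO_support.addSubmonoid_closure fun g hg => (hx g hg).le).mono
      (Set.iUnion_subset fun n => HahnSeries.SummableFamily.support_pow_subset_closure x n)
  refine ⟨hpwo, fun g => ?_⟩
  by_cases hg : g ∈ ⋃ n : ℕ, (x ^ n).support
  swap
  · exact Set.finite_empty.subset fun n hn => hg (Set.mem_iUnion.2 ⟨n, hn⟩)
  refine hpwo.isWF.induction (P := fun g => {n : ℕ | (x ^ n).coeff g ≠ 0}.Finite) hg
    fun y _ hy => ?_
  refine ((((Finset.antidiagonal x.isPWO_support hpwo y).finite_toSet.biUnion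
    (t := fun ij => {n : ℕ | (x ^ n).coeff ij.2 ≠ 0}) ?_).image Nat.succ).union
      (Set.finite_singleton 0)).subset ?_
  · intro ij hij
    obtain ⟨hi, hj, hs⟩ := Finset.mem_antidiagonal.1 (Finset.mem_coe.1 hij)
    exact hy ij.2 hj (hs ▸ lt_add_of_pos_left ij.2 (hx _ hi))
  · rintro (_ | n) hn
    · exact Or.inr rfl
    · have hn' : y ∈ (x * x ^ n).support := by rw [← pow_succ']; exact hn
      obtain ⟨i, hi, j, hj, rfl⟩ := HahnSeries.support_mul_subset hn'
      refine Or.inl ⟨n, Set.mem_iUnion₂.2 ⟨(i, j), ?_, hj⟩, rfl⟩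
      exact Finset.mem_coe.2
        (Finset.mem_antidiagonal.2 ⟨hi, Set.mem_iUnion.2 ⟨n, hj⟩, rfl⟩)

theorem exists_one_sub_mul_eq_one (e : MalcevNeumann Φ) (he : ∀ g, e.coeff g ≠ 0 → 0 < g) :
    ∃ b, (1 - e) * b = 1 := by
  have hx : ∀ g ∈ (toHahn e).support, 0 < g := by
    rw [toHahn_support]; exact he
  obtain ⟨hpwo, hfin⟩ := hahn_pow_finite hx
  have hsupp : ∀ n : ℕ, (toHahn e ^ n).support = Function.support (e ^ n).coeff := fun n => by
    rw [← toHahn_pow, toHahn_support]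
  have hfin' : ∀ g, (Function.support fun n : ℕ => (e ^ n).coeff g).Finite := fun g =>
    (hfin g).subset fun n hn => by
      have : g ∈ Function.support (e ^ n).coeff := hn
      rwa [← hsupp] at this
  have hne : ∀ g, (∑ᶠ n : ℕ, (e ^ n).coeff g) ≠ 0 → ∃ n : ℕ, (e ^ n).coeff g ≠ 0 := fun g hg => by
    by_contra! h
    exact hg (by simp [h])
  let b : MalcevNeumann Φ :=
    { coeff := fun g => ∑ᶠ n : ℕ, (e ^ n).coeff g
      isWF_support := hpwo.isWF.mono (by
        intro g hg
        obtain ⟨n, hn⟩ := hne g hg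
        refine Set.mem_iUnion.2 ⟨n, ?_⟩
        rw [hsupp]
        exact hn) }
  refine ⟨b, ?_⟩
  have key : e * b + 1 = b := by
    ext g
    have hb : Function.support b.coeff ⊆ ⋃ n : ℕ, (toHahn e ^ n).support := by
      intro g hg
      obtain ⟨n, hn⟩ := hne g hg
      refine Set.mem_iUnion.2 ⟨n, ?_⟩
      rw [hsupp]
      exact hn
    have hmul : ∀ c : MalcevNeumann Φ,
        Function.support c.coeff ⊆ (⋃ n : ℕ, (toHahn e ^ n).support) →
        (e * c).coeff g = ∑ xy ∈ Finset.antidiagonal e.isPWO_support hpwo g,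
          e.coeff xy.1 * Φ (Multiplicative.ofAdd xy.1) (c.coeff xy.2) := by
      intro c hc
      rw [coeff_mul]
      refine Finset.sum_subset ?_ ?_
      · intro xy hxy
        rw [Finset.mem_antidiagonal] at hxy ⊢
        exact ⟨hxy.1, hc hxy.2.1, hxy.2.2⟩
      · intro xy hxy hn
        rw [Finset.mem_antidiagonal] at hxy hn
        have : c.coeff xy.2 = 0 := by
          by_contra h
          exact hn ⟨hxy.1, h, hxy.2.2⟩
        simp [this]
    have h1 : (e * b).coeff g = ∑ᶠ n : ℕ, (e ^ (n + 1)).coeff g := by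
      rw [hmul b hb]
      have h2 : ∀ n : ℕ, (e ^ (n + 1)).coeff g =
          ∑ xy ∈ Finset.antidiagonal e.isPWO_support hpwo g,
            e.coeff xy.1 * Φ (Multiplicative.ofAdd xy.1) ((e ^ n).coeff xy.2) := by
        intro n
        rw [pow_succ', hmul _ ((hsupp n).symm.le.trans
          (Set.subset_iUnion (fun n : ℕ => (toHahn e ^ n).support) n))]
      simp_rw [h2]
      have hf : ∀ xy : G × G, (Function.support fun n : ℕ =>
          e.coeff xy.1 * Φ (Multiplicative.ofAdd xy.1) ((e ^ n).coeff xy.2)).Finite := fun xy =>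
        (hfin' xy.2).subset fun n hn h0 => hn (by simp only [h0, map_zero, mul_zero])
      rw [finsum_sum_comm _ _ fun xy _ => hf xy]
      refine Finset.sum_congr rfl fun xy _ => ?_
      have := AddMonoidHom.map_finsum (twist Φ xy.1 (e.coeff xy.1)) (hfin' xy.2)
      exact this
    rw [coeff_add, h1]
    change _ = ∑ᶠ n : ℕ, (e ^ n).coeff g
    have h3 : (∑ᶠ n : ℕ, (e ^ (n + 1)).coeff g) =
        ∑ᶠ n ∈ Set.range Nat.succ, (e ^ n).coeff g := by
      rw [finsum_mem_range Nat.succ_injective]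
    have h4 : (1 : MalcevNeumann Φ).coeff g = ∑ᶠ n ∈ ({0} : Set ℕ), (e ^ n).coeff g := by
      simp
    rw [h3, h4, add_comm, ← finsum_mem_union']
    · have hu : ({0} ∪ Set.range Nat.succ : Set ℕ) = Set.univ := by
        ext n
        rcases n with _ | n <;> simp
      rw [hu, finsum_mem_univ]
    · rw [Set.disjoint_left]
      rintro _ rfl ⟨n, hn⟩
      exact Nat.succ_ne_zero n hn
    · exact (Set.finite_singleton 0).inter_of_left _
    · exact (hfin' g).inter_of_right _
  rw [sub_mul, one_mul, sub_eq_iff_eq_add, add_comm]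
  exact key.symm

theorem coeff_mul_single (a : MalcevNeumann Φ) (x z : G) (c : K) :
    (a * single x c).coeff z =
      a.coeff (z - x) * Φ (Multiplicative.ofAdd (z - x)) c := by
  rw [coeff_mul]
  by_cases h : a.coeff (z - x) = 0 ∨ c = 0
  · rw [Finset.sum_eq_zero]
    · rcases h with h | h <;> simp [h]
    · intro xy hxy
      rw [Finset.mem_antidiagonal] at hxy
      obtain ⟨h1, h2, h3⟩ := hxy
      rw [Function.mem_support, coeff_single] at h2
      by_cases h4 : xy.2 = x
      · rw [if_pos h4] at h2
        have h5 : xy.1 = z - x := by rw [← h3, h4, add_sub_cancel_right]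
        rw [h5] at h1
        exact absurd h (not_or.2 ⟨h1, h2⟩)
      · exact absurd (if_neg h4) h2
  · rw [not_or] at h
    rw [Finset.sum_eq_single (z - x, x)]
    · simp [coeff_single]
    · intro xy hxy hne
      rw [Finset.mem_antidiagonal] at hxy
      rw [coeff_single, if_neg]
      · simp
      · intro h4
        exact hne (Prod.ext (by simp [← hxy.2.2, h4]) h4)
    · intro hn
      exact absurd (Finset.mem_antidiagonal.2
        ⟨h.1, by simpa [coeff_single] using h.2, sub_add_cancel z x⟩) hn

theorem exists_mul_eq_one (a : MalcevNeumann Φ) (ha : a ≠ 0) : ∃ b, a * b = 1 := by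
  have hne : (Function.support a.coeff).Nonempty := by
    by_contra h
    refine ha (MalcevNeumann.ext ?_)
    exact Function.support_eq_empty_iff.1 (Set.not_nonempty_iff_eq_empty.1 h)
  let g := a.isWF_support.min hne
  have hg : a.coeff g ≠ 0 := a.isWF_support.min_mem hne
  have hmin : ∀ x, a.coeff x ≠ 0 → g ≤ x := fun x hx => a.isWF_support.min_le hne hx
  let c : K := (Φ (Multiplicative.ofAdd g)).symm (a.coeff g)⁻¹
  have h0 : (a * single (-g) c).coeff 0 = 1 := by
    rw [coeff_mul_single]
    simp [c, hg]
  obtain ⟨b, hb⟩ := exists_one_sub_mul_eq_one (1 - a * single (-g) c) (by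
    intro x hx
    rw [sub_eq_add_neg, coeff_add, coeff_neg, coeff_one] at hx
    rcases eq_or_ne x 0 with rfl | hx0
    · simp [h0] at hx
    · rw [if_neg hx0, zero_add, neg_ne_zero, coeff_mul_single] at hx
      have h1 := hmin _ (left_ne_zero_of_mul hx)
      rw [sub_neg_eq_add] at h1
      exact lt_of_le_of_ne (le_add_iff_nonneg_left g |>.1 h1) hx0.symm)
  refine ⟨single (-g) c * b, ?_⟩
  rw [← mul_assoc]
  simpa using hb

instance instDivisionRing : DivisionRing (MalcevNeumann Φ) :=
  DivisionRing.ofIsUnitOrEqZero fun a => by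
    by_cases ha : a = 0
    · exact Or.inr ha
    · left
      obtain ⟨b, hb⟩ := exists_mul_eq_one a ha
      have hb0 : b ≠ 0 := by
        rintro rfl
        exact zero_ne_one ((mul_zero a).symm.trans hb)
      obtain ⟨c, hc⟩ := exists_mul_eq_one b hb0
      have hac : a = c := by
        rw [← mul_one a, ← hc, ← mul_assoc, hb, one_mul]
      exact ⟨⟨a, b, hb, hac ▸ hc⟩, rfl⟩

end Construction

end MalcevNeumann

/-! ### The example -/

/-- `K = ℚ(√p₀, √p₁, …)`, a subfield of `ℝ`. -/
abbrev sqrtField (p : ℕ → ℕ) : IntermediateField ℚ ℝ :=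
  IntermediateField.adjoin ℚ (Set.range fun i => √(p i : ℝ))

/-- `√p_i` as an element of `K`. -/
def sqrtGen (p : ℕ → ℕ) (i : ℕ) : sqrtField p :=
  ⟨√(p i : ℝ), IntermediateField.subset_adjoin ℚ _ (Set.mem_range_self i)⟩

/-- `f i (√p_i) = -√p_i` and `f i (√p_j) = √p_j` for `j ≠ i`. -/
def IsSqrtSignChange (p : ℕ → ℕ) (f : ℕ → (sqrtField p ≃ₐ[ℚ] sqrtField p)) : Prop :=
  ∀ i, f i (sqrtGen p i) = -sqrtGen p i ∧ ∀ j, j ≠ i → f i (sqrtGen p j) = sqrtGen p j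

theorem sqrtGen_map (p : ℕ → ℕ) (s : sqrtField p ≃ₐ[ℚ] sqrtField p) (i : ℕ) :
    s (sqrtGen p i) = sqrtGen p i ∨ s (sqrtGen p i) = -sqrtGen p i := by
  have h : sqrtGen p i ^ 2 = (p i : sqrtField p) := by
    apply Subtype.ext
    simp [sqrtGen]
  apply sq_eq_sq_iff_eq_or_eq_neg.1
  rw [← map_pow, h, map_natCast]

theorem sqrtField_aut_comm (p : ℕ → ℕ) (s t : sqrtField p ≃ₐ[ℚ] sqrtField p) :
    s * t = t * s := by
  have h : ((s * t : sqrtField p ≃ₐ[ℚ] sqrtField p) : sqrtField p →ₐ[ℚ] sqrtField p) =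
      ((t * s : sqrtField p ≃ₐ[ℚ] sqrtField p) : sqrtField p →ₐ[ℚ] sqrtField p) := by
    refine IntermediateField.algHom_ext_of_eq_adjoin _ rfl ?_
    rintro x ⟨i, rfl⟩
    change s (t (sqrtGen p i)) = t (s (sqrtGen p i))
    rcases sqrtGen_map p s i with h1 | h1 <;> rcases sqrtGen_map p t i with h2 | h2 <;>
      simp [h1, h2]
  ext x : 1
  exact DFunLike.congr_fun h x

/-- `Gal(K/ℚ)` is commutative. -/
instance (p : ℕ → ℕ) : CommGroup (sqrtField p ≃ₐ[ℚ] sqrtField p) where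
  mul_comm := sqrtField_aut_comm p

/-- The free abelian group `G = ⨁ ℤ` of countable rank with the lexicographic order: `x < y` iff
`x i < y i` at the first index `i` where they differ. -/
abbrev LexFreeAb : Type := Lex (ℕ →₀ ℤ)

/-- The generator `x_i` of `G`. -/
def LexFreeAb.gen (i : ℕ) : LexFreeAb := toLex (Finsupp.single i 1)

/-- The homomorphism `Φ : G → Gal(K/ℚ)`, `Φ_x = ∏ f_i ^ n_i` for `x = (n_0, n_1, …)`. -/
def galHom {p : ℕ → ℕ} (f : ℕ → (sqrtField p ≃ₐ[ℚ] sqrtField p)) :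
    Multiplicative LexFreeAb →* (sqrtField p ≃ₐ[ℚ] sqrtField p) where
  toFun x := (ofLex x.toAdd).prod fun i n => f i ^ n
  map_one' := Finsupp.prod_zero_index
  map_mul' _ _ := Finsupp.prod_add_index' (fun _ => zpow_zero _) fun _ _ _ => zpow_add _ _ _

section Example

variable {p : ℕ → ℕ} (f : ℕ → (sqrtField p ≃ₐ[ℚ] sqrtField p))

theorem LexFreeAb.neg_gen_strictMono : StrictMono fun i => -LexFreeAb.gen i := by
  intro i j hij
  refine neg_lt_neg ?_
  refine ⟨i, fun k hk => ?_, ?_⟩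
  · simp [gen, hk.ne', (hk.trans hij).ne']
  · simp [gen, hij.ne']

open scoped Classical in
/-- `γ = x_0⁻¹ + x_1⁻¹ + ⋯` in `D = K((G, Φ))`. -/
def gammaSeries : MalcevNeumann (galHom f) where
  coeff g := if ∃ i, g = -LexFreeAb.gen i then 1 else 0
  isWF_support := by
    have h : (Set.range fun i => -LexFreeAb.gen i).IsWF := by
      rw [← Set.image_univ]
      exact (((Set.isWF_univ_iff.2 inferInstance).isPWO).image_of_monotone
        LexFreeAb.neg_gen_strictMono.monotone).isWF
    refine h.mono fun g hg => ?_
    by_contra hn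
    exact hg (if_neg fun ⟨i, hi⟩ => hn ⟨i, hi.symm⟩)

/-- `R_n = F(√p_0, …, √p_{n-1}, x_0, …, x_{n-1}, γ)`, a division subring of `D = K((G, Φ))` with
center `F`. -/
def Rn (n : ℕ) : Subfield (MalcevNeumann (galHom f)) :=
  Subfield.closure ((Subring.center (MalcevNeumann (galHom f)) : Set (MalcevNeumann (galHom f))) ∪
    (fun i => MalcevNeumann.single 0 (sqrtGen p i)) '' Set.Iio n ∪
    (fun i => MalcevNeumann.single (LexFreeAb.gen i) 1) '' Set.Iio n ∪ {gammaSeries f})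

theorem Rn_mono : Monotone (Rn f) := by
  intro m n h
  have h' : Set.Iio m ⊆ Set.Iio n := Set.Iio_subset_Iio h
  apply Subfield.closure_mono
  gcongr

/-- `R_∞ = ⋃ R_n`. -/
def Rinfty : Subfield (MalcevNeumann (galHom f)) :=
  (⨆ n, Rn f n).copy (⋃ n, (Rn f n : Set (MalcevNeumann (galHom f))))
    (Subfield.coe_iSup_of_directed (Rn_mono f).directed_le).symm

end Example

end

/-! Local finiteness is compared with weak local finiteness through one fact: a division ring D that
maps to a nonzero finite dimensional algebra E over a field Z is centrally finite, whatever the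
relation between Z and the centre of D (`isCentrallyFinite_of_ringHom`). By a density argument,
elements of D independent over its centre are separated by operators built from left and right
multiplications; these operators extend Z-linearly to E, so the images stay independent over Z and
are finite in number. Applied to F(S) this gives the first claim. Applied to R_n it reduces weak
local finiteness of R_∞ to central finiteness of each R_n, because a finite set lies in a single
R_n.

R_n is centrally finite (`isCentrallyFinite_Rn`) because the tail x_n⁻¹ + x_{n+1}⁻¹ + ⋯ commutes
with √p_j for j < n and is therefore central in R_n. So γ is a central element plus finitely many
x_i⁻¹, and R_n is generated over its centre by the √p_i and x_i with i < n. These have central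
squares and commute up to sign, so they generate a finite module.

γ is not algebraic over the centre of R_∞ for reasons of parity. A central element commutes with
every √p_j, and Φ_x(√p_j) = ±√p_j according to the parity of the j-th exponent, so only even
exponents occur in it. But γ^n contains x_0⁻¹⋯x_{n-1}⁻¹, whose n odd entries no lower power of γ can
produce, so the leading term of a polynomial in γ survives (`sum_mul_gammaSeries_pow_ne_zero`).
Local finiteness would force algebraicity.

The sign changes f_i come from infinite Galois theory once √p_i is known not to lie in the field
generated by the other roots. -/

/-! ### Division subrings of finite dimensional algebras -/

open scoped Classical in
/-- Elements of a division ring which are linearly independent over the center are separated by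
operators built from left and right multiplications. -/
theorem exists_multiplication_operator {D ι : Type*} [DivisionRing D]
    (M : Subring (Module.End ℤ D)) (hL : ∀ a, LinearMap.mulLeft ℤ a ∈ M)
    (hR : ∀ a, LinearMap.mulRight ℤ a ∈ M) (d : ι → D) (s : Finset ι)
    (hd : LinearIndepOn (Subring.center D) d (s : Set ι)) :
    ∀ i ∈ s, ∃ T ∈ M, ∀ j ∈ s, T (d j) = if j = i then 1 else 0 := by
  induction s using Finset.induction_on with
  | empty => simp
  | insert m s hm ih =>
    rw [Finset.coe_insert, linearIndepOn_insert (by simpa using hm)] at hd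
    obtain ⟨hds, hdm⟩ := hd
    choose! T hTM hT using ih hds
    -- Otherwise every operator killing the `d j`, `j ∈ s`, also kills `d m`. Interpolating with the
    -- `T i` makes each `U (d m)` a combination of the `U (d i)` with right coefficients `T i (d
    -- m)`. Those coefficients turn out to be central, so `U = 1` puts `d m` in the span of the
    -- others.
    obtain ⟨U, hUM, hU, hUm⟩ : ∃ U ∈ M, (∀ j ∈ s, U (d j) = 0) ∧ U (d m) ≠ 0 := by
      by_contra! hcon
      have key : ∀ U ∈ M, U (d m) = ∑ i ∈ s, U (d i) * T i (d m) := by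
        intro U hU
        have h := hcon (U - ∑ i ∈ s, LinearMap.mulLeft ℤ (U (d i)) * T i)
          (M.sub_mem hU (M.sum_mem fun i hi => M.mul_mem (hL _) (hTM i hi))) (by
            intro j hj
            rw [LinearMap.sub_apply, LinearMap.sum_apply, sub_eq_zero,
              Finset.sum_eq_single_of_mem j hj]
            · simp [Module.End.mul_apply, hT j hj j hj]
            · intro i hi hij
              simp [Module.End.mul_apply, hT i hi j hj, hij.symm])
        rw [LinearMap.sub_apply, LinearMap.sum_apply, sub_eq_zero] at h
        simpa using h
      have hc : ∀ i ∈ s, T i (d m) ∈ Subring.center D := by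
        intro i hi
        rw [Subring.mem_center_iff]
        intro b
        -- This operator sends `d i` to `b` and the other `d j` to 0, so `key` says that `T i (d m)`
        -- commutes with `b`.
        have h := key (LinearMap.mulRight ℤ b * T i) (M.mul_mem (hR b) (hTM i hi))
        rw [Finset.sum_eq_single_of_mem i hi] at h
        · simpa [Module.End.mul_apply, hT i hi i hi] using h.symm
        · intro j hj hji
          simp [Module.End.mul_apply, hT i hi j hj, hji]
      refine hdm ?_
      have h := key 1 M.one_mem
      simp only [Module.End.one_apply] at h
      rw [h]
      refine Submodule.sum_mem _ fun i hi => ?_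
      rw [(Subring.mem_center_iff.1 (hc i hi)) (d i)]
      exact Submodule.smul_mem _ (⟨_, hc i hi⟩ : Subring.center D)
        (Submodule.subset_span ⟨i, hi, rfl⟩)
    have hV : ∃ V ∈ M, (∀ j ∈ s, V (d j) = 0) ∧ V (d m) = 1 :=
      ⟨LinearMap.mulLeft ℤ (U (d m))⁻¹ * U, M.mul_mem (hL _) hUM,
        fun j hj => by simp [Module.End.mul_apply, hU j hj],
        by simp [Module.End.mul_apply, hUm]⟩
    obtain ⟨V, hVM, hV, hVm⟩ := hV
    intro i hi
    rcases Finset.mem_insert.1 hi with hi | hi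
    · subst hi
      refine ⟨V, hVM, fun j hj => ?_⟩
      rcases Finset.mem_insert.1 hj with hj | hj
      · simp [hj, hVm]
      · rw [hV j hj, if_neg]
        exact fun h : j = i => hm (h ▸ hj)
    · refine ⟨T i - LinearMap.mulLeft ℤ (T i (d m)) * V,
        M.sub_mem (hTM i hi) (M.mul_mem (hL _) hVM), fun j hj => ?_⟩
      rcases Finset.mem_insert.1 hj with hj | hj
      · have : m ≠ i := by
          rintro rfl
          exact hm hi
        simp [hj, Module.End.mul_apply, LinearMap.sub_apply, hVm, this]
      · simp [Module.End.mul_apply, LinearMap.sub_apply, hV j hj, hT i hi j hj]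

/-- The additive endomorphisms of `D` which are induced, along `φ`, by a linear endomorphism. -/
def extendableEnd {D E : Type*} (Z : Type*) [DivisionRing D] [CommRing Z] [Ring E] [Algebra Z E]
    (φ : D →+* E) : Subring (Module.End ℤ D) where
  carrier := {T | ∃ T' : E →ₗ[Z] E, ∀ x, T' (φ x) = φ (T x)}
  mul_mem' := by
    rintro S T ⟨S', hS⟩ ⟨T', hT⟩
    exact ⟨S' ∘ₗ T', fun x => by simp [hS, hT, Module.End.mul_apply]⟩
  one_mem' := ⟨LinearMap.id, fun x => by simp⟩
  add_mem' := by
    rintro S T ⟨S', hS⟩ ⟨T', hT⟩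
    exact ⟨S' + T', fun x => by simp [hS, hT]⟩
  zero_mem' := ⟨0, fun x => by simp⟩
  neg_mem' := by
    rintro S ⟨S', hS⟩
    exact ⟨-S', fun x => by simp [hS]⟩

/-- A division ring which embeds in a finite dimensional algebra is centrally finite. -/
theorem isCentrallyFinite_of_ringHom {D E : Type*} (Z : Type*) [DivisionRing D] [Field Z] [Ring E]
    [Nontrivial E] [Algebra Z E] [Module.Finite Z E] (φ : D →+* E) : IsCentrallyFinite D := by
  classical
  let b := Module.Basis.ofVectorSpace (Subring.center D) D
  have hli : LinearIndependent Z (φ ∘ b) := by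
    rw [linearIndependent_iff']
    intro s g hg i hi
    -- The extension `T'` of the separating operator is Z-linear, so applying it to the relation
    -- isolates the coefficient `g i`.
    obtain ⟨T, ⟨T', hT'⟩, hT⟩ := exists_multiplication_operator (extendableEnd Z φ)
      (fun a => ⟨LinearMap.mulLeft Z (φ a), fun x => by simp⟩)
      (fun a => ⟨LinearMap.mulRight Z (φ a), fun x => by simp⟩) b s
      (b.linearIndependent.linearIndepOn _) i hi
    have h := congrArg T' hg
    rw [map_sum, map_zero, Finset.sum_eq_single_of_mem i hi] at h
    · rw [map_smul, Function.comp_apply, hT', hT i hi, if_pos rfl, map_one] at h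
      exact (smul_eq_zero_iff_left one_ne_zero).1 h
    · intro j hj hji
      rw [map_smul, Function.comp_apply, hT', hT j hj, if_neg hji, map_zero, smul_zero]
  have := hli.finite
  exact Module.Finite.of_basis b

/-- The centre of the division subring generated by `S` is not compared with F; the embedding in
F(S) is enough. -/
theorem IsLocallyFiniteDivisionRing.isWeaklyLocallyFinite {D : Type*} [DivisionRing D]
    (h : IsLocallyFiniteDivisionRing D) : IsWeaklyLocallyFiniteDivisionRing D := by
  intro S hS
  have := h S hS
  have hle : (Subfield.closure S).toSubring ≤ (centerAdjoin S).toSubring :=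
    Subfield.closure_mono Set.subset_union_right
  let φ : Subfield.closure S →+* centerAdjoin S :=
    (Subring.inclusion hle : (Subfield.closure S).toSubring →+* (centerAdjoin S).toSubring)
  exact isCentrallyFinite_of_ringHom (Subring.center D) φ

theorem IsLocallyFiniteDivisionRing.isAlgebraic {D : Type*} [DivisionRing D]
    (h : IsLocallyFiniteDivisionRing D) : Algebra.IsAlgebraic (Subring.center D) D := by
  refine ⟨fun a => ?_⟩
  have := h {a} (Set.finite_singleton a)
  have ha : a ∈ centerAdjoin {a} := Subfield.subset_closure (Or.inr rfl)
  have := Algebra.IsAlgebraic.isAlgebraic (R := Subring.center D) (⟨a, ha⟩ : centerAdjoin {a})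
  exact this.algHom (centerAdjoin {a}).val

/-! ### Sign changes on `ℚ(√p₀, √p₁, …)` -/

/-- If `a, q` lie in an intermediate field `L` and `a` is a square in `L(√q)`, then `a` or `a q` is
a square in `L`. -/
theorem IntermediateField.exists_sq_of_sq_mem_adjoin_sqrt {k E : Type*} [Field k] [Field E]
    [Algebra k E] [CharZero k] (L : IntermediateField k E) {a q r x : E} (ha : a ∈ L) (hq : q ∈ L)
    (hr : r ^ 2 = q) (hx : x ^ 2 = a)
    (hxL : x ∈ IntermediateField.adjoin k (insert r (L : Set E))) :
    (∃ y ∈ L, y ^ 2 = a) ∨ ∃ y ∈ L, y ^ 2 = a * q := by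
  have : CharZero E := charZero_of_injective_algebraMap (algebraMap k E).injective
  by_cases hrL : r ∈ L
  · left
    refine ⟨x, ?_, hx⟩
    have : IntermediateField.adjoin k (insert r (L : Set E)) ≤ L :=
      IntermediateField.adjoin_le_iff.2 (Set.insert_subset hrL le_rfl)
    exact this hxL
  -- Since r ∉ L, the elements 1 and r are independent over L.
  have hne : ∀ u ∈ L, ∀ v ∈ L, u + v * r = 0 → u = 0 ∧ v = 0 := by
    intro u hu v hv h
    by_cases hv0 : v = 0
    · subst hv0
      simpa using h
    · refine absurd ?_ hrL
      have : r = -u / v := by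
        field_simp
        linear_combination h
      rw [this]
      exact L.div_mem (L.neg_mem hu) hv
  -- L + Lr is already a field: inverses come from multiplying by the conjugate u - vr.
  have hform : ∃ u ∈ L, ∃ v ∈ L, x = u + v * r := by
    clear hx
    induction hxL using IntermediateField.adjoin_induction with
    | mem y hy =>
      rcases hy with rfl | hy
      · exact ⟨0, L.zero_mem, 1, L.one_mem, by simp⟩
      · exact ⟨y, hy, 0, L.zero_mem, by simp⟩
    | algebraMap y => exact ⟨_, L.algebraMap_mem y, 0, L.zero_mem, by simp⟩
    | add y z _ _ hy hz =>
      obtain ⟨u, hu, v, hv, rfl⟩ := hy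
      obtain ⟨u', hu', v', hv', rfl⟩ := hz
      exact ⟨u + u', L.add_mem hu hu', v + v', L.add_mem hv hv', by ring⟩
    | inv y _ hy =>
      obtain ⟨u, hu, v, hv, rfl⟩ := hy
      by_cases h0 : u + v * r = 0
      · exact ⟨0, L.zero_mem, 0, L.zero_mem, by simp [h0]⟩
      have h1 : u - v * r ≠ 0 := by
        intro h
        obtain ⟨hu0, hv0⟩ := hne u hu (-v) (L.neg_mem hv) (by linear_combination h)
        exact h0 (by rw [hu0, neg_eq_zero.1 hv0]; simp)
      have h2 : u ^ 2 - v ^ 2 * q = (u + v * r) * (u - v * r) := by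
        linear_combination v ^ 2 * hr
      have hN : u ^ 2 - v ^ 2 * q ∈ L :=
        L.sub_mem (pow_mem hu 2) (L.mul_mem (pow_mem hv 2) hq)
      refine ⟨u / (u ^ 2 - v ^ 2 * q), L.div_mem hu hN, -v / (u ^ 2 - v ^ 2 * q),
        L.div_mem (L.neg_mem hv) hN, ?_⟩
      rw [h2]
      field_simp
      ring
    | mul y z _ _ hy hz =>
      obtain ⟨u, hu, v, hv, rfl⟩ := hy
      obtain ⟨u', hu', v', hv', rfl⟩ := hz
      exact ⟨u * u' + v * v' * q,
        L.add_mem (L.mul_mem hu hu') (L.mul_mem (L.mul_mem hv hv') hq), u * v' + v * u',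
        L.add_mem (L.mul_mem hu hv') (L.mul_mem hv hu'), by linear_combination v * v' * hr⟩
  obtain ⟨u, hu, v, hv, rfl⟩ := hform
  -- Comparing coefficients in (u + vr)² = a gives u² + v²q = a and 2uv = 0. If u = 0, then aq =
  -- (vq)²; if v = 0, then a = u².
  have h2 := hne (u ^ 2 + v ^ 2 * q - a)
    (L.sub_mem (L.add_mem (pow_mem hu 2) (L.mul_mem (pow_mem hv 2) hq)) ha) (2 * (u * v))
    (L.mul_mem (ofNat_mem L 2) (L.mul_mem hu hv)) (by linear_combination hx - v ^ 2 * hr)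
  rcases mul_eq_zero.1 ((mul_eq_zero.1 h2.2).resolve_left two_ne_zero) with h0 | h0
  · right
    refine ⟨v * q, L.mul_mem hv hq, ?_⟩
    subst h0
    linear_combination q * h2.1
  · left
    refine ⟨u, hu, ?_⟩
    subst h0
    linear_combination h2.1

/-- The roots are removed one at a time; each removal keeps `a` or replaces it by `a * p m`, which
is why the induction quantifies over `a`. `U` records the factors collected. -/
theorem exists_isSquare_mul_prod_of_sq_mem_adjoin_sqrt (p : ℕ → ℕ) (T : Finset ℕ) :
    ∀ (a : ℚ) (x : ℝ), x ^ 2 = a →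
      x ∈ IntermediateField.adjoin ℚ ((fun i => √(p i : ℝ)) '' (T : Set ℕ)) →
      ∃ U ⊆ T, IsSquare (a * ∏ i ∈ U, (p i : ℚ)) := by
  induction T using Finset.induction_on with
  | empty =>
    intro a x hx hxT
    rw [Finset.coe_empty, Set.image_empty, IntermediateField.adjoin_empty,
      IntermediateField.mem_bot] at hxT
    obtain ⟨y, rfl⟩ := hxT
    refine ⟨∅, le_rfl, y, ?_⟩
    have : (y : ℝ) ^ 2 = a := hx
    rw [Finset.prod_empty, mul_one, ← sq]
    exact_mod_cast this.symm
  | insert m T hm ih =>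
    intro a x hx hxT
    rw [Finset.coe_insert, Set.image_insert_eq, ← IntermediateField.adjoin_insert_adjoin] at hxT
    have hrat : ∀ c : ℚ, (c : ℝ) ∈ IntermediateField.adjoin ℚ
        ((fun i => √(p i : ℝ)) '' (T : Set ℕ)) := fun c => IntermediateField.algebraMap_mem _ c
    rcases IntermediateField.exists_sq_of_sq_mem_adjoin_sqrt _ (hrat a)
      (hrat (p m)) (by simp) hx hxT with ⟨y, hy, hya⟩ | ⟨y, hy, hya⟩
    · obtain ⟨U, hU, h⟩ := ih a y hya hy
      exact ⟨U, hU.trans (Finset.subset_insert _ _), h⟩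
    · obtain ⟨U, hU, h⟩ := ih (a * p m) y (by push_cast at hya ⊢; exact hya) hy
      refine ⟨insert m U, Finset.insert_subset_insert _ hU, ?_⟩
      rwa [Finset.prod_insert fun h => hm (hU h), ← mul_assoc]

theorem sqrt_notMem_adjoin_sqrt {p : ℕ → ℕ} (hinj : Function.Injective p)
    (hp : ∀ i, (p i).Prime) (i : ℕ) :
    √(p i : ℝ) ∉ IntermediateField.adjoin ℚ ((fun j => √(p j : ℝ)) '' {i}ᶜ) := by
  intro h
  obtain ⟨T', hT', h⟩ := IntermediateField.exists_finset_of_mem_adjoin h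
  obtain ⟨T, hT, rfl⟩ := Finset.subset_set_image_iff.1 hT'
  rw [Finset.coe_image] at h
  obtain ⟨U, hU, r, hr⟩ :=
    exists_isSquare_mul_prod_of_sq_mem_adjoin_sqrt p T (p i) _ (by simp) h
  have hiU : i ∉ U := fun h => hT (hU h) rfl
  have hsq : IsSquare (p i * ∏ j ∈ U, p j) := by
    rw [← Rat.isSquare_natCast_iff]
    exact ⟨r, by push_cast; exact hr⟩
  obtain ⟨m, hm⟩ := hsq
  -- In the square p_i ∏_{j ∈ U} p_j the prime p_i must divide the product over `U`, although `i ∉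
  -- U` and the primes are distinct.
  have hdvd : p i ∣ m := by
    have : p i ∣ m * m := hm ▸ dvd_mul_right _ _
    rcases (hp i).dvd_mul.1 this with h | h <;> exact h
  obtain ⟨l, rfl⟩ := hdvd
  have h2 : ∏ j ∈ U, p j = p i * (l * l) := by
    apply Nat.eq_of_mul_eq_mul_left (hp i).pos
    rw [hm]
    ring
  have h3 : p i ∣ ∏ j ∈ U, p j := h2 ▸ dvd_mul_right _ _
  obtain ⟨j, hj, hij⟩ := ((hp i).prime.dvd_finsetProd_iff _).1 h3
  rw [(Nat.prime_dvd_prime_iff_eq (hp i) (hp j))] at hij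
  exact hiU (hinj hij ▸ hj)

/-- K is generated by the roots of the polynomials X² - p_i, which split in K, and separability is
automatic in characteristic 0. -/
instance isGalois_sqrtField (p : ℕ → ℕ) : IsGalois ℚ (sqrtField p) := by
  have hint : ∀ x ∈ Set.range fun i => √(p i : ℝ), IsIntegral ℚ x := by
    rintro _ ⟨i, rfl⟩
    exact ⟨Polynomial.X ^ 2 - Polynomial.C (p i : ℚ), Polynomial.monic_X_pow_sub_C _ two_ne_zero,
      by simp⟩
  have halg : Algebra.IsAlgebraic ℚ (sqrtField p) := IntermediateField.isAlgebraic_adjoin hint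
  have hsplit : ∀ x ∈ Set.range fun i => √(p i : ℝ), IsIntegral ℚ x ∧
      ((minpoly ℚ x).map (algebraMap ℚ (sqrtField p))).Splits := by
    intro x hx
    refine ⟨hint x hx, ?_⟩
    obtain ⟨i, rfl⟩ := hx
    have hdvd : minpoly ℚ (√(p i : ℝ)) ∣ Polynomial.X ^ 2 - Polynomial.C (p i : ℚ) :=
      minpoly.dvd _ _ (by simp)
    have hs : ((Polynomial.X ^ 2 - Polynomial.C (p i : ℚ)).map
        (algebraMap ℚ (sqrtField p))) =
        (Polynomial.X - Polynomial.C (sqrtGen p i)) * (Polynomial.X + Polynomial.C (sqrtGen p i)) := by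
      have h : sqrtGen p i ^ 2 = (p i : sqrtField p) := by
        apply Subtype.ext
        simp [sqrtGen]
      rw [Polynomial.map_sub, Polynomial.map_pow, Polynomial.map_X, Polynomial.map_C,
        map_natCast, ← h, Polynomial.C_pow]
      ring
    refine Polynomial.Splits.of_dvd (g := (Polynomial.X ^ 2 - Polynomial.C (p i : ℚ)).map
        (algebraMap ℚ (sqrtField p))) ?_ ?_ (Polynomial.map_dvd _ hdvd)
    · rw [hs]
      exact (Polynomial.Splits.X_sub_C _).mul (Polynomial.Splits.X_add_C _)
    · exact Polynomial.map_ne_zero (Polynomial.X_pow_sub_C_ne_zero two_pos _)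
  have : Normal ℚ (sqrtField p) := by
    refine normal_iff.2 fun x => ⟨halg.isIntegral.isIntegral x, ?_⟩
    rw [← minpoly.algebraMap_eq (algebraMap (sqrtField p) ℝ).injective]
    exact IntermediateField.splits_of_mem_adjoin ℚ ℝ hsplit x.2
  constructor

theorem exists_isSqrtSignChange {p : ℕ → ℕ} (hinj : Function.Injective p)
    (hp : ∀ i, (p i).Prime) :
    ∃ f : ℕ → (sqrtField p ≃ₐ[ℚ] sqrtField p), IsSqrtSignChange p f := by
  have key : ∀ i, ∃ s : sqrtField p ≃ₐ[ℚ] sqrtField p,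
      s (sqrtGen p i) = -sqrtGen p i ∧ ∀ j, j ≠ i → s (sqrtGen p j) = sqrtGen p j := by
    intro i
    let L : IntermediateField ℚ (sqrtField p) :=
      IntermediateField.adjoin ℚ (sqrtGen p '' {i}ᶜ)
    have hL : sqrtGen p i ∉ L := by
      intro h
      refine sqrt_notMem_adjoin_sqrt hinj hp i (?_ : (sqrtGen p i : ℝ) ∈ _)
      generalize sqrtGen p i = y at h
      induction h using IntermediateField.adjoin_induction with
      | mem x hx =>
        obtain ⟨j, hj, rfl⟩ := hx
        exact IntermediateField.subset_adjoin ℚ _ ⟨j, hj, rfl⟩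
      | algebraMap x =>
        rw [eq_ratCast]
        exact IntermediateField.algebraMap_mem _ x
      | add x y _ _ hx hy => exact IntermediateField.add_mem _ hx hy
      | inv x _ hx => exact IntermediateField.inv_mem _ hx
      | mul x y _ _ hx hy => exact IntermediateField.mul_mem _ hx hy
    -- L is the fixed field of its fixing subgroup, so some automorphism fixes every √p_j with j ≠ i
    -- and moves √p_i; it can only change the sign.
    rw [← InfiniteGalois.fixedField_fixingSubgroup L, IntermediateField.mem_fixedField_iff] at hL
    push Not at hL
    obtain ⟨s, hs, hsi⟩ := hL
    refine ⟨s, (sqrtGen_map p s i).resolve_left hsi, fun j hj => ?_⟩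
    exact (IntermediateField.mem_fixingSubgroup_iff _ _).1 hs _
      (IntermediateField.subset_adjoin ℚ _ ⟨j, hj, rfl⟩)
  choose f hf using key
  exact ⟨f, hf⟩

/-! ### Commutation in `K((G, Φ))` -/

namespace MalcevNeumann

set_option linter.unusedSectionVars false

variable {k K G : Type*} [Field k] [Field K] [Algebra k K]
  [AddCommGroup G] [LinearOrder G] [IsOrderedAddMonoid G]
  {Φ : Multiplicative G →* (K ≃ₐ[k] K)}

theorem coeff_single_mul (a : MalcevNeumann Φ) (x z : G) (c : K) :
    (single x c * a).coeff z = c * Φ (Multiplicative.ofAdd x) (a.coeff (z - x)) := by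
  rw [coeff_mul]
  by_cases h : a.coeff (z - x) = 0 ∨ c = 0
  · rw [Finset.sum_eq_zero]
    · rcases h with h | h <;> simp [h]
    · intro xy hxy
      obtain ⟨h1, h2, h3⟩ := Finset.mem_antidiagonal.1 hxy
      rw [Function.mem_support, coeff_single] at h1
      by_cases h4 : xy.1 = x
      · rw [if_pos h4] at h1
        have h5 : xy.2 = z - x := by rw [← h3, h4, add_sub_cancel_left]
        rw [h5] at h2
        exact absurd h (not_or.2 ⟨h2, h1⟩)
      · exact absurd (if_neg h4) h1
  · rw [not_or] at h
    rw [Finset.sum_eq_single (x, z - x)]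
    · simp [coeff_single]
    · intro xy hxy hne
      rw [coeff_single, if_neg, zero_mul]
      intro h4
      exact hne (Prod.ext h4 (by simp [← (Finset.mem_antidiagonal.1 hxy).2.2, h4]))
    · intro hn
      exact absurd (Finset.mem_antidiagonal.2
        ⟨by simpa [coeff_single] using h.2, h.1, add_sub_cancel x z⟩) hn

theorem single_mul_single (x y : G) (c d : K) :
    (single x c * single y d : MalcevNeumann Φ) =
      single (x + y) (c * Φ (Multiplicative.ofAdd x) d) := by
  ext z
  simp only [coeff_single_mul, coeff_single, sub_eq_iff_eq_add']
  split_ifs <;> simp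

theorem single_zero_one : (single 0 1 : MalcevNeumann Φ) = 1 := rfl

theorem single_neg (x : G) (c : K) : (single x (-c) : MalcevNeumann Φ) = -single x c := by
  ext z
  rw [coeff_neg, coeff_single, coeff_single]
  split_ifs <;> simp

theorem inv_single_one (x : G) : (single x 1 : MalcevNeumann Φ)⁻¹ = single (-x) 1 := by
  apply inv_eq_of_mul_eq_one_right
  rw [single_mul_single, ← single_zero_one]
  simp

/-- The coefficients at z are c·a_z and a_z·Φ_z(c), and a_z cancels in K when it is nonzero. -/
theorem commute_single_zero_iff (a : MalcevNeumann Φ) (c : K) :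
    Commute (single 0 c) a ↔
      ∀ z, a.coeff z ≠ 0 → Φ (Multiplicative.ofAdd z) c = c := by
  rw [Commute, SemiconjBy, MalcevNeumann.ext_iff, funext_iff]
  refine forall_congr' fun z => ?_
  rw [coeff_single_mul, coeff_mul_single, sub_zero, ofAdd_zero, map_one, AlgEquiv.one_apply,
    mul_comm c]
  constructor
  · intro h hz
    exact (mul_left_cancel₀ hz h).symm
  · intro h
    by_cases hz : a.coeff z = 0
    · simp [hz]
    · rw [h hz]

theorem commute_single_one_iff (a : MalcevNeumann Φ) (x : G) :
    Commute (single x 1) a ↔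
      ∀ z, Φ (Multiplicative.ofAdd x) (a.coeff z) = a.coeff z := by
  rw [Commute, SemiconjBy, MalcevNeumann.ext_iff, funext_iff]
  simp only [coeff_single_mul, coeff_mul_single, map_one, one_mul, mul_one]
  exact ⟨fun h z => by simpa using h (z + x), fun h z => h _⟩

/-- The coefficient of a series at a given exponent, as an additive map. -/
def coeffHom (Φ : Multiplicative G →* (K ≃ₐ[k] K)) (z : G) : MalcevNeumann Φ →+ K where
  toFun a := a.coeff z
  map_zero' := rfl
  map_add' _ _ := rfl

theorem coeff_sum {ι : Type*} (s : Finset ι) (a : ι → MalcevNeumann Φ) (z : G) :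
    (∑ i ∈ s, a i).coeff z = ∑ i ∈ s, (a i).coeff z :=
  map_sum (coeffHom Φ z) a s

end MalcevNeumann

open MalcevNeumann

/-! ### Parity of exponents and the action of Φ on square roots -/

section SignChange

variable {p : ℕ → ℕ} {f : ℕ → (sqrtField p ≃ₐ[ℚ] sqrtField p)}

theorem sqrtGen_ne_zero (hp : ∀ i, (p i).Prime) (i : ℕ) : sqrtGen p i ≠ 0 := by
  intro h
  have h' : √(p i : ℝ) = 0 := congrArg Subtype.val h
  rw [Real.sqrt_eq_zero (Nat.cast_nonneg _)] at h'
  exact (hp i).ne_zero (by exact_mod_cast h')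

theorem galHom_gen (i : ℕ) : galHom f (Multiplicative.ofAdd (LexFreeAb.gen i)) = f i := by
  change (Finsupp.single i (1 : ℤ)).prod (fun i n => f i ^ n) = f i
  rw [Finsupp.prod_single_index] <;> simp

/-- `f i` is an involution, since its square fixes all the generators of K; only the parity of `n`
matters. -/
theorem IsSqrtSignChange.zpow_apply (hf : IsSqrtSignChange p f) (i : ℕ) (n : ℤ) (j : ℕ) :
    (f i ^ n) (sqrtGen p j) = if j = i ∧ Odd n then -sqrtGen p j else sqrtGen p j := by
  have h2 : f i * f i = 1 := by
    have h : ((f i * f i : sqrtField p ≃ₐ[ℚ] sqrtField p) : sqrtField p →ₐ[ℚ] sqrtField p) =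
        ((1 : sqrtField p ≃ₐ[ℚ] sqrtField p) : sqrtField p →ₐ[ℚ] sqrtField p) := by
      refine IntermediateField.algHom_ext_of_eq_adjoin _ rfl ?_
      rintro x ⟨j, rfl⟩
      change f i (f i (sqrtGen p j)) = sqrtGen p j
      by_cases hj : j = i
      · subst hj
        simp [(hf j).1]
      · simp [(hf i).2 j hj]
    ext x : 1
    exact DFunLike.congr_fun h x
  rcases Int.even_or_odd' n with ⟨m, rfl | rfl⟩
  · rw [zpow_mul, zpow_two, h2, one_zpow, if_neg]
    · rfl
    · simp
  · rw [zpow_add, zpow_mul, zpow_two, h2, one_zpow, one_mul, zpow_one]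
    by_cases hj : j = i
    · subst hj
      simp [(hf j).1]
    · simp [(hf i).2 j hj, hj]

theorem IsSqrtSignChange.galHom_apply (hf : IsSqrtSignChange p f) (x : LexFreeAb) (j : ℕ) :
    galHom f (Multiplicative.ofAdd x) (sqrtGen p j) =
      if Odd (ofLex x j) then -sqrtGen p j else sqrtGen p j := by
  have key : ∀ y : ℕ →₀ ℤ, (y.prod fun i n => f i ^ n) (sqrtGen p j) =
      if Odd (y j) then -sqrtGen p j else sqrtGen p j := by
    intro y
    induction y using Finsupp.induction with
    | zero => simp
    | single_add i n y hi hn ih =>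
      rw [Finsupp.prod_add_index' (fun _ => zpow_zero _) fun _ _ _ => zpow_add _ _ _,
        Finsupp.prod_single_index (zpow_zero _), AlgEquiv.mul_apply, ih]
      by_cases hj : j = i
      · subst hj
        have h0 : y j = 0 := by simpa using hi
        simp [h0, hf.zpow_apply]
      · have : (Finsupp.single i n) j = 0 := by simp [Ne.symm hj]
        rw [apply_ite (f i ^ n), map_neg, hf.zpow_apply, if_neg (c := j = i ∧ Odd n) fun h => hj h.1, Finsupp.add_apply,
          this, zero_add]
  exact key (ofLex x)

/-- An odd j-th exponent would make Φ_x negate √p_j, contrary to the commutation criterion. This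
constrains the central elements of R_∞. -/
theorem IsSqrtSignChange.even_of_commute (hp : ∀ i, (p i).Prime) (hf : IsSqrtSignChange p f)
    {a : MalcevNeumann (galHom f)} {j : ℕ} (ha : Commute (single 0 (sqrtGen p j)) a)
    {x : LexFreeAb} (hx : a.coeff x ≠ 0) : Even (ofLex x j) := by
  have h := (commute_single_zero_iff _ _).1 ha x hx
  rw [hf.galHom_apply] at h
  by_contra hodd
  rw [if_pos (Int.not_even_iff_odd.1 hodd), neg_eq_self] at h
  exact sqrtGen_ne_zero hp j h

end SignChange

/-! ### Algebras generated by elements commuting up to sign -/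

/-- Left multiplication by a nonzero `a` is injective on a finite dimensional space, hence hits 1.
-/
theorem Subalgebra.inv_mem_of_finite {Z E : Type*} [Field Z] [DivisionRing E] [Algebra Z E]
    (A : Subalgebra Z E) [Module.Finite Z A] {a : E} (ha : a ∈ A) : a⁻¹ ∈ A := by
  by_cases h0 : a = 0
  · simp [h0]
  have hinj : Function.Injective (LinearMap.mulLeft Z (⟨a, ha⟩ : A)) := by
    intro x y hxy
    exact Subtype.ext (mul_left_cancel₀ h0 (congrArg Subtype.val hxy))
  obtain ⟨b, hb⟩ := LinearMap.injective_iff_surjective.1 hinj 1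
  have hb' : a * b = 1 := congrArg Subtype.val hb
  rw [inv_eq_of_mul_eq_one_right hb']
  exact b.2

/-- A finite subalgebra containing generators of a division ring is everything. -/
theorem module_finite_of_forall_mem {Z D : Type*} [Field Z] [DivisionRing D] {S : Set D}
    {R : Subfield D} (hR : R = Subfield.closure S) [Algebra Z R] (A : Subalgebra Z R)
    [Module.Finite Z A] (h : ∀ (y : D) (hy : y ∈ S), ⟨y, hR ▸ Subfield.subset_closure hy⟩ ∈ A) :
    Module.Finite Z R := by
  subst hR
  have htop : A = ⊤ := by
    rw [eq_top_iff]
    rintro ⟨v, hv⟩ -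
    induction hv using Subfield.closure_induction with
    | mem y hy => exact h y hy
    | one => exact A.one_mem
    | add y z hy hz hyA hzA => exact A.add_mem hyA hzA
    | neg y hy hyA => exact A.neg_mem hyA
    | inv y hy hyA => exact A.inv_mem_of_finite hyA
    | mul y z hy hz hyA hzA => exact A.mul_mem hyA hzA
  subst htop
  exact Module.Finite.equiv (Subalgebra.topEquiv (R := Z)).toLinearEquiv

section SignCommuting

variable {Z E : Type*} [CommRing Z] [Ring E] [Algebra Z E]

theorem one_mem_span_one_pair (u : E) : (1 : E) ∈ Submodule.span Z {1, u} :=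
  Submodule.subset_span (Or.inl rfl)

theorem mem_span_one_pair (u : E) : u ∈ Submodule.span Z {1, u} :=
  Submodule.subset_span (Or.inr rfl)

theorem span_one_pair_mul_self {u : E} (hu : ∃ z, u * u = algebraMap Z E z) :
    Submodule.span Z {1, u} * Submodule.span Z {1, u} = Submodule.span Z {1, u} := by
  apply le_antisymm
  · rw [Submodule.span_mul_span, Submodule.span_le]
    rintro _ ⟨a, rfl | rfl, b, rfl | rfl, rfl⟩
    · simpa using one_mem_span_one_pair u
    · simpa using mem_span_one_pair b
    · simpa using mem_span_one_pair a
    · obtain ⟨z, hz⟩ := hu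
      have := Submodule.smul_mem _ z (one_mem_span_one_pair (Z := Z) b)
      rwa [← Algebra.algebraMap_eq_smul_one, ← hz] at this
  · intro x hx
    simpa using Submodule.mul_mem_mul (one_mem_span_one_pair (Z := Z) u) hx

/-- A span absorbs signs, so generators commuting up to sign have spans that genuinely commute as
submodules. -/
theorem span_one_pair_mul_le {u v : E} (h : u * v = v * u ∨ u * v = -(v * u)) :
    Submodule.span Z {1, u} * Submodule.span Z {1, v} ≤
      Submodule.span Z {1, v} * Submodule.span Z {1, u} := by
  rw [Submodule.span_mul_span, Submodule.span_le]
  rintro _ ⟨a, rfl | rfl, b, rfl | rfl, rfl⟩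
  · exact Submodule.mul_mem_mul (one_mem_span_one_pair _) (one_mem_span_one_pair _)
  · simpa using Submodule.mul_mem_mul (mem_span_one_pair (Z := Z) b) (one_mem_span_one_pair u)
  · simpa using Submodule.mul_mem_mul (one_mem_span_one_pair (Z := Z) v) (mem_span_one_pair a)
  · have := Submodule.mul_mem_mul (mem_span_one_pair (Z := Z) b) (mem_span_one_pair (Z := Z) a)
    rcases h with h | h
    · simpa [h] using this
    · simpa [h] using this

/-- Finitely many elements with scalar squares which commute pairwise up to sign lie in a
subalgebra that is finite as a module. -/
theorem exists_finite_subalgebra {ι : Type*} [Finite ι] (u : ι → E)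
    (hsq : ∀ i, ∃ z, u i * u i = algebraMap Z E z)
    (hcomm : ∀ i j, u i * u j = u j * u i ∨ u i * u j = -(u j * u i)) :
    ∃ A : Subalgebra Z E, Module.Finite Z A ∧ ∀ i, u i ∈ A := by
  cases nonempty_fintype ι
  let N : ι → Submodule Z E := fun i => Submodule.span Z {1, u i}
  have hN : ∀ i j, Commute (N i) (N j) := fun i j =>
    le_antisymm (span_one_pair_mul_le (hcomm i j)) (span_one_pair_mul_le (hcomm j i))
  -- Each `N i` is a finitely generated idempotent submodule containing 1; since they commute, their
  -- product has the same properties and is thus a subalgebra.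
  have key : ∀ l : List ι, (l.map N).prod * (l.map N).prod = (l.map N).prod ∧
      (l.map N).prod.FG ∧ 1 ∈ (l.map N).prod ∧ ∀ i ∈ l, u i ∈ (l.map N).prod := by
    intro l
    induction l with
    | nil =>
      refine ⟨by simp, ?_, Submodule.one_le.1 le_rfl, by simp⟩
      rw [List.map_nil, List.prod_nil, Submodule.one_eq_span]
      exact Submodule.fg_span_singleton 1
    | cons i l ih =>
      obtain ⟨h1, h2, h3, h4⟩ := ih
      have hc : Commute (N i) (l.map N).prod := by
        refine Commute.list_prod_right _ _ fun x hx => ?_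
        obtain ⟨j, -, rfl⟩ := List.mem_map.1 hx
        exact hN i j
      rw [List.map_cons, List.prod_cons]
      refine ⟨?_, Submodule.FG.mul (Submodule.fg_span (by simp)) h2, ?_, ?_⟩
      · rw [hc.symm.mul_mul_mul_comm, h1, span_one_pair_mul_self (hsq i)]
      · simpa using Submodule.mul_mem_mul (one_mem_span_one_pair (Z := Z) (u i)) h3
      · intro j hj
        rcases List.mem_cons.1 hj with rfl | hj
        · simpa using Submodule.mul_mem_mul (mem_span_one_pair (Z := Z) (u j)) h3
        · simpa using Submodule.mul_mem_mul (one_mem_span_one_pair (Z := Z) (u i)) (h4 j hj)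
  obtain ⟨h1, h2, h3, h4⟩ := key Finset.univ.toList
  refine ⟨Submodule.toSubalgebra _ h3 fun x y hx hy => h1 ▸ Submodule.mul_mem_mul hx hy,
    Module.Finite.iff_fg.2 h2, fun i => h4 i (by simp)⟩

end SignCommuting

/-! ### The division rings `R_n` -/

section Rn

variable {p : ℕ → ℕ} {f : ℕ → (sqrtField p ≃ₐ[ℚ] sqrtField p)} {n : ℕ}

theorem LexFreeAb.gen_injective : Function.Injective LexFreeAb.gen := by
  intro i j h
  exact LexFreeAb.neg_gen_strictMono.injective (congrArg Neg.neg h)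

theorem center_subset_Rn {z : MalcevNeumann (galHom f)} (hz : z ∈ Subring.center _) :
    z ∈ Rn f n :=
  Subfield.subset_closure (Or.inl (Or.inl (Or.inl hz)))

theorem single_sqrtGen_mem_Rn {i : ℕ} (hi : i < n) :
    (single 0 (sqrtGen p i) : MalcevNeumann (galHom f)) ∈ Rn f n :=
  Subfield.subset_closure (Or.inl (Or.inl (Or.inr ⟨i, hi, rfl⟩)))

theorem single_gen_mem_Rn {i : ℕ} (hi : i < n) :
    (single (LexFreeAb.gen i) 1 : MalcevNeumann (galHom f)) ∈ Rn f n :=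
  Subfield.subset_closure (Or.inl (Or.inr ⟨i, hi, rfl⟩))

theorem gammaSeries_mem_Rn : gammaSeries f ∈ Rn f n :=
  Subfield.subset_closure (Or.inr rfl)

/-- The elements commuting with `w` form a division subring, so commutation need only be tested on
generators, and those from F commute automatically. -/
theorem mem_center_Rn {w : MalcevNeumann (galHom f)} (hw : w ∈ Rn f n)
    (h1 : ∀ i < n, Commute (single 0 (sqrtGen p i)) w)
    (h2 : ∀ i < n, Commute (single (LexFreeAb.gen i) 1) w) (h3 : Commute (gammaSeries f) w) :
    (⟨w, hw⟩ : Rn f n) ∈ Subring.center (Rn f n) := by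
  rw [Subring.mem_center_iff]
  rintro ⟨v, hv⟩
  apply Subtype.ext
  change Commute v w
  induction hv using Subfield.closure_induction with
  | mem x hx =>
    rcases hx with ((hx | ⟨i, hi, rfl⟩) | ⟨i, hi, rfl⟩) | rfl
    · exact ((Subring.mem_center_iff.1 hx) w).symm
    · exact h1 i hi
    · exact h2 i hi
    · exact h3
  | one => exact Commute.one_left w
  | add x y _ _ hx hy => exact hx.add_left hy
  | neg x _ hx => exact hx.neg_left
  | inv x _ hx => exact hx.inv_left₀
  | mul x y _ _ hx hy => exact hx.mul_left hy

open scoped Classical in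
theorem coeff_gammaSeries (z : LexFreeAb) :
    (gammaSeries f).coeff z = if ∃ i, z = -LexFreeAb.gen i then 1 else 0 := rfl

theorem commute_single_gen_gammaSeries (i : ℕ) :
    Commute (single (LexFreeAb.gen i) 1) (gammaSeries f) := by
  rw [commute_single_one_iff]
  intro z
  rw [coeff_gammaSeries]
  split_ifs <;> simp

theorem commute_single_gen (i j : ℕ) :
    Commute (single (LexFreeAb.gen i) 1 : MalcevNeumann (galHom f))
      (single (LexFreeAb.gen j) 1) := by
  rw [commute_single_one_iff]
  intro z
  rw [coeff_single]
  split_ifs <;> simp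

theorem commute_single_sqrtGen (i j : ℕ) :
    Commute (single 0 (sqrtGen p i) : MalcevNeumann (galHom f)) (single 0 (sqrtGen p j)) := by
  rw [Commute, SemiconjBy, single_mul_single, single_mul_single]
  simp [mul_comm]

theorem single_gen_mul_single_sqrtGen (hf : IsSqrtSignChange p f) (i j : ℕ) :
    (single (LexFreeAb.gen i) 1 * single 0 (sqrtGen p j) : MalcevNeumann (galHom f)) =
      single 0 (sqrtGen p j) * single (LexFreeAb.gen i) 1 ∨
    (single (LexFreeAb.gen i) 1 * single 0 (sqrtGen p j) : MalcevNeumann (galHom f)) =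
      -(single 0 (sqrtGen p j) * single (LexFreeAb.gen i) 1) := by
  rw [single_mul_single, single_mul_single, galHom_gen, ← single_neg]
  by_cases hj : j = i
  · subst hj
    simp [(hf j).1]
  · simp [(hf i).2 j hj]

theorem commute_single_sqrtGen_sq (i : ℕ) (a : MalcevNeumann (galHom f)) :
    Commute (single 0 (sqrtGen p i) * single 0 (sqrtGen p i)) a := by
  have h : sqrtGen p i * sqrtGen p i = (p i : sqrtField p) := by
    apply Subtype.ext
    simp [sqrtGen]
  rw [single_mul_single, add_zero, ofAdd_zero, map_one, AlgEquiv.one_apply, h,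
    commute_single_zero_iff]
  intro z _
  exact map_natCast _ _

theorem commute_single_sqrtGen_single_gen_sq (hf : IsSqrtSignChange p f) (i j : ℕ) :
    Commute (single 0 (sqrtGen p j) : MalcevNeumann (galHom f))
      (single (LexFreeAb.gen i) 1 * single (LexFreeAb.gen i) 1) := by
  rw [single_mul_single, commute_single_zero_iff]
  intro z hz
  rw [coeff_single] at hz
  have hz : z = LexFreeAb.gen i + LexFreeAb.gen i := by
    by_contra h
    exact hz (if_neg h)
  rw [hf.galHom_apply, if_neg]
  rw [Int.not_odd_iff_even, hz]
  exact ⟨_, rfl⟩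

/-- The tail `x_n⁻¹ + x_{n+1}⁻¹ + ⋯` of `γ`. -/
noncomputable def gammaTail (f : ℕ → (sqrtField p ≃ₐ[ℚ] sqrtField p)) (n : ℕ) : MalcevNeumann (galHom f) :=
  gammaSeries f - ∑ i ∈ Finset.range n, (single (LexFreeAb.gen i) 1)⁻¹

theorem exists_of_coeff_gammaTail_ne_zero {z : LexFreeAb} (hz : (gammaTail f n).coeff z ≠ 0) :
    ∃ i, n ≤ i ∧ z = -LexFreeAb.gen i := by
  simp only [gammaTail, sub_eq_add_neg, coeff_add, coeff_neg, MalcevNeumann.coeff_sum,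
    inv_single_one, coeff_single, coeff_gammaSeries] at hz
  by_cases h : ∃ i, z = -LexFreeAb.gen i
  · obtain ⟨i, rfl⟩ := h
    refine ⟨i, ?_, rfl⟩
    by_contra! hi
    refine hz ?_
    rw [if_pos ⟨i, rfl⟩, Finset.sum_eq_single_of_mem i (Finset.mem_range.2 hi), if_pos rfl,
      add_neg_cancel]
    intro j _ hj
    exact if_neg fun h => hj (LexFreeAb.gen_injective (neg_injective h)).symm
  · refine absurd ?_ hz
    rw [if_neg h, Finset.sum_eq_zero, neg_zero, add_zero]
    intro i _
    exact if_neg fun h' => h ⟨i, h'⟩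

/-- The tail involves only x_i with i ≥ n, whose automorphisms fix √p_j for j < n. This is what
makes the tail central in R_n. -/
theorem commute_single_sqrtGen_gammaTail (hf : IsSqrtSignChange p f) {j : ℕ} (hj : j < n) :
    Commute (single 0 (sqrtGen p j)) (gammaTail f n) := by
  rw [commute_single_zero_iff]
  intro z hz
  obtain ⟨i, hi, rfl⟩ := exists_of_coeff_gammaTail_ne_zero hz
  rw [hf.galHom_apply, if_neg]
  have : ofLex (-LexFreeAb.gen i) j = 0 := by
    simp [LexFreeAb.gen, (hj.trans_le hi).ne']
  rw [this]
  exact Int.not_odd_zero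

theorem isCentrallyFinite_Rn (hf : IsSqrtSignChange p f) (n : ℕ) : IsCentrallyFinite (Rn f n) := by
  let s : Fin n → Rn f n := fun i => ⟨_, single_sqrtGen_mem_Rn i.2⟩
  let x : Fin n → Rn f n := fun i => ⟨_, single_gen_mem_Rn i.2⟩
  have hcomm : ∀ i j, Sum.elim s x i * Sum.elim s x j = Sum.elim s x j * Sum.elim s x i ∨
      Sum.elim s x i * Sum.elim s x j = -(Sum.elim s x j * Sum.elim s x i) := by
    rintro (i | i) (j | j)
    · exact Or.inl (Subtype.ext (commute_single_sqrtGen i.1 j.1))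
    · rcases single_gen_mul_single_sqrtGen hf j.1 i.1 with h | h
      · exact Or.inl (Subtype.ext h.symm)
      · exact Or.inr (Subtype.ext (neg_eq_iff_eq_neg.1 h.symm))
    · rcases single_gen_mul_single_sqrtGen hf i.1 j.1 with h | h
      · exact Or.inl (Subtype.ext h)
      · exact Or.inr (Subtype.ext h)
    · exact Or.inl (Subtype.ext (commute_single_gen i.1 j.1))
  have hsq : ∀ i, ∃ z, Sum.elim s x i * Sum.elim s x i =
      algebraMap (Subring.center (Rn f n)) (Rn f n) z := by
    rintro (i | i)
    · exact ⟨⟨s i * s i, mem_center_Rn (s i * s i).2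
        (fun j _ => (commute_single_sqrtGen_sq i.1 _).symm)
        (fun j _ => (commute_single_sqrtGen_sq i.1 _).symm)
        (commute_single_sqrtGen_sq i.1 _).symm⟩, rfl⟩
    · exact ⟨⟨x i * x i, mem_center_Rn (x i * x i).2
        (fun j _ => commute_single_sqrtGen_single_gen_sq hf i.1 j)
        (fun j _ => (commute_single_gen j i.1).mul_right (commute_single_gen j i.1))
        ((commute_single_gen_gammaSeries i.1).mul_left
          (commute_single_gen_gammaSeries i.1)).symm⟩, rfl⟩
  obtain ⟨A, hA, hmem⟩ := exists_finite_subalgebra (Sum.elim s x) hsq hcomm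
  have htail : gammaTail f n ∈ Rn f n :=
    (Rn f n).sub_mem gammaSeries_mem_Rn ((Rn f n).sum_mem fun i hi =>
      (Rn f n).inv_mem (single_gen_mem_Rn (Finset.mem_range.1 hi)))
  have hγ : ∀ w, (∀ i < n, Commute w (single (LexFreeAb.gen i) 1)) → Commute w (gammaSeries f) →
      Commute w (gammaTail f n) := fun w hw h =>
    h.sub_right (Commute.sum_right _ _ _ fun i hi => (hw i (Finset.mem_range.1 hi)).inv_right₀)
  have htailA : (⟨_, htail⟩ : Rn f n) ∈ A :=
    A.algebraMap_mem (⟨_, mem_center_Rn htail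
      (fun j hj => commute_single_sqrtGen_gammaTail hf hj)
      (fun j _ => hγ _ (fun i _ => commute_single_gen j i) (commute_single_gen_gammaSeries j))
      (hγ _ (fun i _ => (commute_single_gen_gammaSeries i).symm) (Commute.refl _))⟩ :
      Subring.center (Rn f n))
  -- γ is the central tail plus the x_i⁻¹, and the inverses remain in `A` because `A` is finite over
  -- a field.
  have hgammaA : (⟨_, gammaSeries_mem_Rn⟩ : Rn f n) ∈ A := by
    have h : (⟨_, gammaSeries_mem_Rn⟩ : Rn f n) = ⟨_, htail⟩ + ∑ i, (x i)⁻¹ := by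
      apply Subtype.ext
      rw [Subfield.coe_add, AddSubmonoidClass.coe_finsetSum]
      simp only [gammaTail, Subfield.coe_inv, x]
      rw [Fin.sum_univ_eq_sum_range
        (fun i => (single (LexFreeAb.gen i) 1 : MalcevNeumann (galHom f))⁻¹), sub_add_cancel]
    rw [h]
    exact A.add_mem htailA (A.sum_mem fun i _ => A.inv_mem_of_finite (hmem (Sum.inr i)))
  refine module_finite_of_forall_mem (R := Rn f n) rfl A ?_
  rintro y (((hy | ⟨i, hi, rfl⟩) | ⟨i, hi, rfl⟩) | rfl)
  · refine A.algebraMap_mem (⟨⟨y, center_subset_Rn hy⟩, ?_⟩ : Subring.center (Rn f n))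
    exact Subring.mem_center_iff.2 fun g => Subtype.ext (Subring.mem_center_iff.1 hy g)
  · exact hmem (Sum.inl ⟨i, hi⟩)
  · exact hmem (Sum.inr ⟨i, hi⟩)
  · exact hgammaA

/-! ### Weak local finiteness of R_∞ -/

theorem mem_Rinfty {w : MalcevNeumann (galHom f)} : w ∈ Rinfty f ↔ ∃ n, w ∈ Rn f n :=
  Set.mem_iUnion

theorem isWeaklyLocallyFinite_Rinfty (hf : IsSqrtSignChange p f) :
    IsWeaklyLocallyFiniteDivisionRing (Rinfty f) := by
  intro S hS
  obtain ⟨n, hn⟩ : ∃ n, ∀ w ∈ S, (w : MalcevNeumann (galHom f)) ∈ Rn f n := by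
    induction S, hS using Set.Finite.induction_on with
    | empty => simp
    | @insert a S _ _ ih =>
      obtain ⟨n, hn⟩ := ih
      obtain ⟨m, hm⟩ := mem_Rinfty.1 a.2
      refine ⟨max m n, ?_⟩
      rintro w (rfl | hw)
      · exact Rn_mono f (le_max_left _ _) hm
      · exact Rn_mono f (le_max_right _ _) (hn w hw)
  -- All of `S` lies in one `Rn f n`, so the division subring it generates embeds there.
  have hle : Subfield.closure S ≤ (Rn f n).comap (Rinfty f).subtype :=
    Subfield.closure_le.2 hn
  let φ : Subfield.closure S →+* Rn f n :=
    ((Rinfty f).subtype.comp (Subfield.closure S).subtype).codRestrict (Rn f n)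
      fun w => hle w.2
  have : Module.Finite (Subring.center (Rn f n)) (Rn f n) := isCentrallyFinite_Rn hf n
  exact isCentrallyFinite_of_ringHom (Subring.center (Rn f n)) φ

end Rn

/-! ### Powers of `γ` -/

section Gamma

variable {p : ℕ → ℕ} {f : ℕ → (sqrtField p ≃ₐ[ℚ] sqrtField p)}

/-- The exponent of the monomial `∏_{i ∈ s} x_i⁻¹`. -/
noncomputable def LexFreeAb.negSum (s : Multiset ℕ) : LexFreeAb :=
  (s.map fun i => -LexFreeAb.gen i).sum

theorem LexFreeAb.negSum_cons (i : ℕ) (s : Multiset ℕ) :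
    LexFreeAb.negSum (i ::ₘ s) = -LexFreeAb.gen i + LexFreeAb.negSum s := by
  simp [LexFreeAb.negSum]

theorem LexFreeAb.negSum_apply (s : Multiset ℕ) (j : ℕ) :
    ofLex (LexFreeAb.negSum s) j = -(s.count j : ℤ) := by
  induction s using Multiset.induction_on with
  | empty => simp [LexFreeAb.negSum]
  | cons i s ih =>
    rw [LexFreeAb.negSum_cons, ofLex_add, Finsupp.add_apply, ih, Multiset.count_cons]
    have : ofLex (-LexFreeAb.gen i) j = -if j = i then 1 else 0 := by
      simp [LexFreeAb.gen, Finsupp.single_apply, eq_comm]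
    rw [this]
    push_cast
    ring

theorem exists_of_coeff_gammaSeries_pow_ne_zero {k : ℕ} {z : LexFreeAb}
    (hz : (gammaSeries f ^ k).coeff z ≠ 0) :
    ∃ s : Multiset ℕ, s.card = k ∧ z = LexFreeAb.negSum s := by
  induction k generalizing z with
  | zero =>
    refine ⟨0, rfl, ?_⟩
    by_contra h
    rw [pow_zero, coeff_one] at hz
    exact hz (if_neg h)
  | succ k ih =>
    rw [pow_succ', coeff_mul] at hz
    obtain ⟨xy, hxy, -⟩ := Finset.exists_ne_zero_of_sum_ne_zero hz
    obtain ⟨hx, hy, rfl⟩ := Finset.mem_antidiagonal.1 hxy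
    obtain ⟨s, hs, hys⟩ := ih hy
    obtain ⟨i, hi⟩ : ∃ i, xy.1 = -LexFreeAb.gen i := by
      by_contra h
      exact hx (if_neg h)
    exact ⟨i ::ₘ s, by simp [hs], by rw [LexFreeAb.negSum_cons, hi, hys]⟩

/-- Natural number coefficients are fixed by every Φ_x and cannot cancel in characteristic 0, so the
support of γ^k can be found without computing multinomial coefficients. -/
theorem exists_natCast_eq_coeff_gammaSeries_pow (k : ℕ) (z : LexFreeAb) :
    ∃ m : ℕ, (gammaSeries f ^ k).coeff z = m := by
  induction k generalizing z with
  | zero =>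
    rw [pow_zero, coeff_one]
    split_ifs
    · exact ⟨1, by simp⟩
    · exact ⟨0, by simp⟩
  | succ k ih =>
    choose N hN using ih
    rw [pow_succ', coeff_mul]
    refine ⟨∑ xy ∈ Finset.antidiagonal (gammaSeries f).isPWO_support
      (gammaSeries f ^ k).isPWO_support z, N xy.2, ?_⟩
    rw [Nat.cast_sum]
    refine Finset.sum_congr rfl fun xy hxy => ?_
    have hx := (Finset.mem_antidiagonal.1 hxy).1
    rw [Function.mem_support, coeff_gammaSeries] at hx
    rw [coeff_gammaSeries, if_pos (by by_contra h; exact hx (if_neg h)), one_mul, hN, map_natCast]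

theorem coeff_gammaSeries_pow_negSum_ne_zero (s : Multiset ℕ) :
    (gammaSeries f ^ s.card).coeff (LexFreeAb.negSum s) ≠ 0 := by
  induction s using Multiset.induction_on with
  | empty => simp [LexFreeAb.negSum, coeff_one]
  | cons i s ih =>
    choose N hN using exists_natCast_eq_coeff_gammaSeries_pow (f := f) s.card
    have hγ : (gammaSeries f).coeff (-LexFreeAb.gen i) ≠ 0 := by
      rw [coeff_gammaSeries, if_pos ⟨i, rfl⟩]
      exact one_ne_zero
    have hsum : (gammaSeries f ^ (i ::ₘ s).card).coeff (LexFreeAb.negSum (i ::ₘ s)) =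
        ((∑ xy ∈ Finset.antidiagonal (gammaSeries f).isPWO_support
          (gammaSeries f ^ s.card).isPWO_support (LexFreeAb.negSum (i ::ₘ s)), N xy.2 : ℕ) :
          sqrtField p) := by
      rw [Multiset.card_cons, pow_succ', coeff_mul, Nat.cast_sum]
      refine Finset.sum_congr rfl fun xy hxy => ?_
      have hx := (Finset.mem_antidiagonal.1 hxy).1
      rw [Function.mem_support, coeff_gammaSeries] at hx
      rw [coeff_gammaSeries, if_pos (by by_contra h; exact hx (if_neg h)), one_mul, hN,
        map_natCast]
    rw [hsum, Nat.cast_ne_zero]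
    -- A vanishing sum of natural numbers has every term zero, including the one from the
    -- factorization x_i⁻¹ · ∏_{j ∈ s} x_j⁻¹, which is nonzero by induction.
    intro h0
    have h := Finset.sum_eq_zero_iff.1 h0 (-LexFreeAb.gen i, LexFreeAb.negSum s)
      (Finset.mem_antidiagonal.2 ⟨hγ, ih, (LexFreeAb.negSum_cons i s).symm⟩)
    rw [hN, Nat.cast_ne_zero] at ih
    exact ih h

/-- Among the exponents of `γ ^ k`, `k ≤ n`, only that of `x_0⁻¹ ⋯ x_{n-1}⁻¹` has its first `n`
entries odd. -/
theorem eq_negSum_range_of_coeff_gammaSeries_pow_ne_zero {k n : ℕ} (hk : k ≤ n) {z : LexFreeAb}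
    (hz : (gammaSeries f ^ k).coeff z ≠ 0) (hodd : ∀ j < n, Odd (ofLex z j)) :
    k = n ∧ z = LexFreeAb.negSum (Multiset.range n) := by
  obtain ⟨s, hs, rfl⟩ := exists_of_coeff_gammaSeries_pow_ne_zero hz
  -- An odd entry is nonzero, so each j < n occurs in `s`; with at most n elements, `s` must then
  -- equal the range.
  have hle : Multiset.range n ≤ s := by
    rw [Multiset.le_iff_subset (Multiset.nodup_range n)]
    intro j hj
    have h := hodd j (Multiset.mem_range.1 hj)
    rw [LexFreeAb.negSum_apply] at h
    by_contra hjs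
    rw [Multiset.count_eq_zero_of_notMem hjs] at h
    simp at h
  have h := Multiset.eq_of_le_of_card_le hle (by rw [hs, Multiset.card_range]; exact hk)
  subst h
  exact ⟨by rw [← hs, Multiset.card_range], rfl⟩

/-- `γ` satisfies no nontrivial polynomial equation whose coefficients have even exponents. -/
theorem sum_mul_gammaSeries_pow_ne_zero (c : ℕ → MalcevNeumann (galHom f)) (n : ℕ)
    (hc : ∀ k x, (c k).coeff x ≠ 0 → ∀ j, Even (ofLex x j)) (hn : c n ≠ 0) :
    ∑ k ∈ Finset.range (n + 1), c k * gammaSeries f ^ k ≠ 0 := by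
  obtain ⟨x, hx⟩ : ∃ x, (c n).coeff x ≠ 0 := by
    by_contra! h
    exact hn (MalcevNeumann.ext (funext h))
  have hone : ∀ j < n, (Multiset.range n).count j = 1 := fun j hj =>
    Multiset.count_eq_one_of_mem (Multiset.nodup_range n) (Multiset.mem_range.2 hj)
  -- At the exponent of x·x_0⁻¹⋯x_{n-1}⁻¹ only one pair contributes to the whole sum: `uv.1` and `x`
  -- have even entries, so the first n entries of `uv.2` are odd.
  have key : ∀ k ≤ n, ∀ uv : LexFreeAb × LexFreeAb, (c k).coeff uv.1 ≠ 0 →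
      (gammaSeries f ^ k).coeff uv.2 ≠ 0 →
      uv.1 + uv.2 = x + LexFreeAb.negSum (Multiset.range n) →
      k = n ∧ uv = (x, LexFreeAb.negSum (Multiset.range n)) := by
    rintro k hk ⟨u, v⟩ hu hv huv
    obtain ⟨h1, h2⟩ := eq_negSum_range_of_coeff_gammaSeries_pow_ne_zero hk hv (by
      intro j hj
      have h := congrArg (fun w : LexFreeAb => ofLex w j) huv
      simp only [ofLex_add, Finsupp.add_apply, LexFreeAb.negSum_apply, hone j hj] at h
      obtain ⟨a, ha⟩ := hc k u hu j
      obtain ⟨b, hb⟩ := hc n x hx j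
      change Odd (ofLex v j)
      -- From u_j = 2a, x_j = 2b and u_j + v_j = x_j - 1 follows v_j = 2(b - a - 1) + 1.
      exact ⟨b - a - 1, by push_cast at h; omega⟩)
    refine ⟨h1, Prod.ext ?_ h2⟩
    simp only at h2 huv
    rw [h2] at huv
    exact add_right_cancel huv
  have hg : (gammaSeries f ^ n).coeff (LexFreeAb.negSum (Multiset.range n)) ≠ 0 := by
    simpa using coeff_gammaSeries_pow_negSum_ne_zero (f := f) (Multiset.range n)
  intro h
  have h' := congrArg (fun a => a.coeff (x + LexFreeAb.negSum (Multiset.range n))) h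
  simp only [MalcevNeumann.coeff_sum, coeff_zero] at h'
  rw [Finset.sum_eq_single_of_mem n (Finset.self_mem_range_succ n), coeff_mul,
    Finset.sum_eq_single_of_mem (x, LexFreeAb.negSum (Multiset.range n))] at h'
  · refine mul_ne_zero hx ?_ h'
    simpa using hg
  · exact Finset.mem_antidiagonal.2 ⟨hx, hg, rfl⟩
  · intro uv huv hne
    obtain ⟨hu, hv, h⟩ := Finset.mem_antidiagonal.1 huv
    exact absurd (key n le_rfl uv hu hv h).2 hne
  · intro k hk hkn
    rw [coeff_mul]
    refine Finset.sum_eq_zero fun uv huv => ?_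
    obtain ⟨hu, hv, h⟩ := Finset.mem_antidiagonal.1 huv
    exact absurd (key k (Nat.lt_succ_iff.1 (Finset.mem_range.1 hk)) uv hu hv h).1 hkn

/-- R_∞ contains every √p_j, so the coefficients of an annihilating polynomial, being central, have
only even exponents, while its leading coefficient is nonzero. -/
theorem not_isAlgebraic_Rinfty (hp : ∀ i, (p i).Prime) (hf : IsSqrtSignChange p f) :
    ¬ Algebra.IsAlgebraic (Subring.center (Rinfty f)) (Rinfty f) := by
  intro h
  obtain ⟨P, hP, hPγ⟩ :=
    h.isAlgebraic ⟨gammaSeries f, mem_Rinfty.2 ⟨0, gammaSeries_mem_Rn⟩⟩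
  refine sum_mul_gammaSeries_pow_ne_zero (f := f) (fun k => ((P.coeff k : Rinfty f) : _))
    P.natDegree ?_ ?_ ?_
  · intro k x hx j
    have hj : (single 0 (sqrtGen p j) : MalcevNeumann (galHom f)) ∈ Rinfty f :=
      mem_Rinfty.2 ⟨j + 1, single_sqrtGen_mem_Rn j.lt_succ_self⟩
    have hcomm : Commute (single 0 (sqrtGen p j) : MalcevNeumann (galHom f))
        ((P.coeff k : Rinfty f) : MalcevNeumann (galHom f)) :=
      congrArg Subtype.val (Subring.mem_center_iff.1 (P.coeff k).2 ⟨_, hj⟩)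
    exact hf.even_of_commute hp hcomm hx
  · intro h0
    exact hP (Polynomial.leadingCoeff_eq_zero.1 (Subtype.ext (Subtype.ext h0)))
  · rw [Polynomial.aeval_eq_sum_range] at hPγ
    have h0 := congrArg (Rinfty f).subtype hPγ
    rw [map_sum, map_zero] at h0
    rw [← h0]
    rfl

end Gamma
-- The proposition
theorem mainTheorem2 :
    -- every locally finite division ring is weakly locally finite
    (∀ (D : Type*) [DivisionRing D],
      IsLocallyFiniteDivisionRing D → IsWeaklyLocallyFiniteDivisionRing D) ∧
    -- some weakly locally finite division ring is not algebraic over its center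
    (∃ (D : Type) (_ : DivisionRing D), IsWeaklyLocallyFiniteDivisionRing D ∧
      ¬ Algebra.IsAlgebraic (Subring.center D) D ∧ ¬ IsLocallyFiniteDivisionRing D) ∧
    -- namely the division ring `R_∞` attached to any increasing sequence of primes
    (∀ p : ℕ → ℕ, StrictMono p → (∀ i, (p i).Prime) →
      (∃ f : ℕ → (sqrtField p ≃ₐ[ℚ] sqrtField p), IsSqrtSignChange p f) ∧
      ∀ f : ℕ → (sqrtField p ≃ₐ[ℚ] sqrtField p), IsSqrtSignChange p f →
        IsWeaklyLocallyFiniteDivisionRing (Rinfty f) ∧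
        ¬ Algebra.IsAlgebraic (Subring.center (Rinfty f)) (Rinfty f) ∧
        ¬ IsLocallyFiniteDivisionRing (Rinfty f)) := by
  have hex : ∀ p : ℕ → ℕ, StrictMono p → (∀ i, (p i).Prime) →
      (∃ f : ℕ → (sqrtField p ≃ₐ[ℚ] sqrtField p), IsSqrtSignChange p f) ∧
      ∀ f : ℕ → (sqrtField p ≃ₐ[ℚ] sqrtField p), IsSqrtSignChange p f →
        IsWeaklyLocallyFiniteDivisionRing (Rinfty f) ∧
        ¬ Algebra.IsAlgebraic (Subring.center (Rinfty f)) (Rinfty f) ∧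
        ¬ IsLocallyFiniteDivisionRing (Rinfty f) := fun p hmono hp =>
    ⟨exists_isSqrtSignChange hmono.injective hp, fun f hf =>
      ⟨isWeaklyLocallyFinite_Rinfty hf, not_isAlgebraic_Rinfty hp hf,
        fun h => not_isAlgebraic_Rinfty hp hf h.isAlgebraic⟩⟩
  refine ⟨fun D _ h => h.isWeaklyLocallyFinite, ?_, hex⟩
  -- The sequence of all primes provides a concrete instance.
  obtain ⟨⟨f, hf⟩, h⟩ := hex (Nat.nth Nat.Prime) (Nat.nth_strictMono Nat.infinite_setOfPred_prime)
    (Nat.prime_nth_prime)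
  exact ⟨Rinfty f, inferInstance, h f hf⟩
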